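/- Let $r\ge 1$, $m\ge 1$, $b\ge 2$ be integers. Consider the asynchronous shared-memory model with one writer and $r$ readers, which are deterministic processes with arbitrary local states (kept from one operation to the next), that communicate only through $n$ physical registers. Each physical register holds one of $b$ values, is atomic (each read and each write takes effect instantaneously), and is single-writer: it can be read by every process, but can be written only by one fixed process, its owner, which may be the writer or any reader. The processes implement a single-writer register with $m$ values and some initial value: the writer may repeatedly invoke operations $\mathrm{write}(v)$ for any of the $m$ values $v$, and each reader may repeatedly invoke $\mathrm{read}$ operations. The implementation is regular if in every execution every completed read returns either the value of the last write completed before the read started (the initial value if there is none) or the value of a write concurrent with the read. It is obstruction-free if from every reachable configuration every pending operation terminates after finitely many steps when its process runs in isolation. Then every obstruction-free regular implementation satisfies $$ n \;\ge\; \left\lceil \min\left(\frac{m-1}{b-1},\; r+\frac{\log m}{\log b}\right)\right\rceil , $$ whether or not there are readers that never write to a physical register. -/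

import Mathlib

universe u

namespace SharedRegister

/-- The processes of the system: `none` is the writer of the implemented register,
`some j` is its `j`-th reader. -/
abbrev Proc (r : ℕ) : Type := Option (Fin r)

/-- Operations that a process can invoke on the implemented `m`-valued register:
the writer invokes `write v` for a value `v`, a reader invokes `read`. -/
abbrev Op {r : ℕ} (m : ℕ) : Proc r → Type
  | none => Fin m
  | some _ => Unit

/-- Responses of these operations: a write returns an acknowledgement, a read returns a value. -/
abbrev Res {r : ℕ} (m : ℕ) : Proc r → Type
  | none => Unit
  | some _ => Fin m

/-- What a process with a pending operation does next, as determined by its local state: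
read physical register `i` and continue in a local state that depends on the value read,
write `x` to physical register `i`, or return from the pending operation. -/
inductive Action (n b : ℕ) (S : Type u) (R : Type) : Type u
  | read (i : Fin n) (k : Fin b → S)
  | write (i : Fin n) (x : Fin b) (s : S)
  | ret (y : R) (s : S)

/-- A (deterministic) algorithm for one writer and `r` readers that provides operations of an
`m`-valued register and communicates through `n` physical single-writer registers, each with
`b` values. Local states are arbitrary and persist from one operation of a process to the next.
Every process may read every physical register, but only its owner may write to it. -/
structure Algorithm (r n m b : ℕ) where
  /-- local states of each process -/
  State : Proc r → Type u
  /-- initial local states -/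
  initState : (p : Proc r) → State p
  /-- initial contents of the physical registers -/
  initMem : Fin n → Fin b
  /-- the process that owns a physical register -/
  owner : Fin n → Proc r
  /-- effect of the invocation of an operation on the local state -/
  start : (p : Proc r) → Op m p → State p → State p
  /-- the next action of a process with a pending operation -/
  action : (p : Proc r) → State p → Action n b (State p) (Res m p)
  /-- the physical registers are single-writer -/
  single_writer : ∀ (p : Proc r) (s : State p) (i : Fin n) (x : Fin b) (s' : State p),
    action p s = Action.write i x s' → owner i = p

/-- Events of an execution: invocation of an operation, an access (read or write) to a physical
register, response of an operation. -/
inductive Event (r m : ℕ) : Type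
  | inv (p : Proc r) (o : Op m p)
  | access (p : Proc r)
  | res (p : Proc r) (y : Res m p)

namespace Algorithm

variable {r n m b : ℕ}

/-- A configuration: contents of all physical registers, local states of all processes, and which
processes have a pending operation. -/
structure Config (A : Algorithm.{u} r n m b) where
  mem : Fin n → Fin b
  state : (p : Proc r) → A.State p
  active : Proc r → Bool

/-- The initial configuration. -/
def init (A : Algorithm.{u} r n m b) : A.Config where
  mem := A.initMem
  state := A.initState
  active := fun _ => false

/-- One step of the system. Accesses to physical registers take effect instantaneously, that is,
the physical registers are atomic. -/
inductive Step (A : Algorithm.{u} r n m b) : A.Config → Event r m → A.Config → Prop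
  | inv (C : A.Config) (p : Proc r) (o : Op m p) (idle : C.active p = false) :
      Step A C (Event.inv p o)
        { mem := C.mem
          state := Function.update C.state p (A.start p o (C.state p))
          active := Function.update C.active p true }
  | read (C : A.Config) (p : Proc r) (i : Fin n) (k : Fin b → A.State p)
      (busy : C.active p = true) (h : A.action p (C.state p) = Action.read i k) :
      Step A C (Event.access p)
        { mem := C.mem
          state := Function.update C.state p (k (C.mem i))
          active := C.active }
  | write (C : A.Config) (p : Proc r) (i : Fin n) (x : Fin b) (s : A.State p)
      (busy : C.active p = true) (h : A.action p (C.state p) = Action.write i x s) :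
      Step A C (Event.access p)
        { mem := Function.update C.mem i x
          state := Function.update C.state p s
          active := C.active }
  | res (C : A.Config) (p : Proc r) (y : Res m p) (s : A.State p)
      (busy : C.active p = true) (h : A.action p (C.state p) = Action.ret y s) :
      Step A C (Event.res p y)
        { mem := C.mem
          state := Function.update C.state p s
          active := Function.update C.active p false }

/-- `A.Execution h C`: some finite execution from the initial configuration has the sequence of
events `h` and ends in the configuration `C`. The schedule and the times of the invocations are
arbitrary; a process that crashes takes no more steps. -/
inductive Execution (A : Algorithm.{u} r n m b) : List (Event r m) → A.Config → Prop
  | nil : Execution A [] A.init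
  | snoc {h : List (Event r m)} {C C' : A.Config} {e : Event r m} :
      Execution A h C → A.Step C e C' → Execution A (h ++ [e]) C'

end Algorithm

variable {r m : ℕ}

/-- After the events `h`, the last completed write is a write of `v`, where the initial value `v₀`
counts as written before the execution starts. -/
def LastCompletedWrite (v₀ : Fin m) (h : List (Event r m)) (v : Fin m) : Prop :=
  (Event.res none () ∉ h ∧ v = v₀) ∨
    ∃ h₁ h₂ h₃ : List (Event r m),
      h = h₁ ++ [Event.inv none v] ++ h₂ ++ [Event.res none ()] ++ h₃ ∧
        Event.res none () ∉ h₂ ∧ Event.res none () ∉ h₃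

/-- After the events `h`, a write of `v` is pending. -/
def PendingWrite (h : List (Event r m)) (v : Fin m) : Prop :=
  ∃ h₁ h₂ : List (Event r m), h = h₁ ++ [Event.inv none v] ++ h₂ ∧ Event.res none () ∉ h₂

/-- The sequence of events `h` satisfies the specification of a regular single-writer register
with initial value `v₀`: every completed read returns the value of the last write that was
completed before the read started, or the value of a write concurrent with the read (one that was
pending when the read started, or was invoked between the start and the end of the read). -/
def Regular (v₀ : Fin m) (h : List (Event r m)) : Prop :=
  ∀ (j : Fin r) (v : Fin m) (h₁ h₂ h₃ : List (Event r m)),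
    h = h₁ ++ [Event.inv (some j) ()] ++ h₂ ++ [Event.res (some j) v] ++ h₃ →
    (∀ w : Fin m, Event.res (some j) w ∉ h₂) →
      LastCompletedWrite v₀ h₁ v ∨ PendingWrite h₁ v ∨ Event.inv none v ∈ h₂

namespace Algorithm

variable {n b : ℕ}

/-- The algorithm implements an `m`-valued regular register (with some initial value). -/
def ImplementsRegular (A : Algorithm.{u} r n m b) : Prop :=
  ∃ v₀ : Fin m, ∀ (h : List (Event r m)) (C : A.Config), A.Execution h C → Regular v₀ h

/-- Obstruction-freedom: from every reachable configuration, every pending operation terminates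
after finitely many steps if its process runs in isolation. (A process with a pending operation
has exactly one possible step.) -/
def ObstructionFree (A : Algorithm.{u} r n m b) : Prop :=
  ∀ (h : List (Event r m)) (C : A.Config), A.Execution h C →
    ∀ p : Proc r, C.active p = true →
      ∃ (C₁ C₂ : A.Config) (y : Res m p),
        Relation.ReflTransGen (fun D D' : A.Config => A.Step D (Event.access p) D') C C₁ ∧
          A.Step C₁ (Event.res p y) C₂

end Algorithm

end SharedRegister

/-! The two terms of the minimum come from two cases.

If every reader owns a register, at least r registers do not belong to the writer. A solo write of v
from the initial configuration changes only the writer's registers, and a subsequent solo read must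
return v. Hence these registers have at least m contents (`le_pow_card_writer_registers`), and n ≥ r
+ log m / log b.

Otherwise some reader never writes, so the writer cannot notice its reads. Count the pairs
(register, content) that the writer can still produce with values from V. Let a solo read at C
return y, and drop y from V (any value, if y is not in V). If no pair could be lost, the writer
could restrict itself to the remaining values and still restore each register to its content in C
just before the reader reads it. The read would again return y, which violates regularity. So each
dropped value costs a pair (`exists_avail_ssubset`). At most nb pairs exist at the start and at
least n remain with one value left, so m - 1 ≤ n(b - 1). -/

namespace SharedRegister

/-! ### Event sequences: writer events, completed and pending writes -/

variable {r m : ℕ}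

/-- The process that takes part in an event. -/
def Event.proc : Event r m → Proc r
  | .inv p _ => p
  | .access p => p
  | .res p _ => p

/-- Events of the writer in which only values from `V` are written. -/
def WriterEvent (V : Finset (Fin m)) (e : Event r m) : Prop :=
  e.proc = none ∧ ∀ v : Fin m, e = Event.inv none v → v ∈ V

theorem WriterEvent.mono {V W : Finset (Fin m)} (h : V ⊆ W) {e : Event r m}
    (he : WriterEvent V e) : WriterEvent W e :=
  ⟨he.1, fun v hv => h (he.2 v hv)⟩

theorem writerEvent_access (V : Finset (Fin m)) :
    WriterEvent V (Event.access none : Event r m) :=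
  ⟨rfl, fun _ h => by cases h⟩

theorem writerEvent_res (V : Finset (Fin m)) (y : Res m (none : Proc r)) :
    WriterEvent V (Event.res none y : Event r m) :=
  ⟨rfl, fun _ h => by cases h⟩

theorem writerEvent_inv {V : Finset (Fin m)} {v : Fin m} (hv : v ∈ V) :
    WriterEvent V (Event.inv none v : Event r m) :=
  ⟨rfl, fun _ h => by cases h; exact hv⟩

theorem LastCompletedWrite.inv_mem {v₀ v : Fin m} {h : List (Event r m)}
    (hres : Event.res none () ∈ h) (hv : LastCompletedWrite v₀ h v) :
    Event.inv none v ∈ h := by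
  rcases hv with ⟨hn, _⟩ | ⟨a, b, c, rfl, _, _⟩
  · exact absurd hres hn
  · simp

theorem PendingWrite.inv_mem {v : Fin m} {h : List (Event r m)} (hv : PendingWrite h v) :
    Event.inv none v ∈ h := by
  obtain ⟨a, b, rfl, _⟩ := hv
  simp

theorem not_pendingWrite_of_ends_with_res {v : Fin m} {h : List (Event r m)} :
    ¬ PendingWrite (h ++ [Event.res none ()]) v := by
  rintro ⟨a, b, hab, hb⟩
  rcases List.eq_nil_or_concat b with rfl | ⟨b', e, rfl⟩
  · have := congrArg List.getLast? hab
    simp at this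
  · rw [List.concat_eq_append, ← List.append_assoc] at hab
    have := (List.append_inj' hab rfl).2
    simp_all

/-- Between two consecutive responses of the writer, the last completed write is the one
invoked between them. -/
theorem LastCompletedWrite.inv_mem_between {v₀ v : Fin m} {g k : List (Event r m)}
    (hv : LastCompletedWrite v₀ (g ++ [Event.res none ()] ++ k ++ [Event.res none ()]) v) :
    Event.inv none v ∈ k := by
  rcases hv with ⟨hn, _⟩ | ⟨a, b, c, habc, hb, hc⟩
  · simp at hn
  -- A nonempty `c` would end with the final response, which `c` must not contain.
  rcases List.eq_nil_or_concat c with rfl | ⟨c', e, rfl⟩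
  · have h1 : (g ++ [Event.res none ()]) ++ k = a ++ ([Event.inv none v] ++ b) := by
      have := List.append_cancel_right (by simpa using habc :
        (g ++ [Event.res none ()] ++ k) ++ [Event.res none ()] =
          (a ++ [Event.inv none v] ++ b) ++ [Event.res none ()])
      simpa using this
    -- If the invocation preceded the earlier response, that response would lie in `b`.
    rcases List.append_eq_append_iff.1 h1 with ⟨d, _, hd⟩ | ⟨d, hd1, hd2⟩
    · simp [hd]
    · rcases List.eq_nil_or_concat d with rfl | ⟨d', e, rfl⟩
      · rw [List.nil_append] at hd2
        simp [← hd2]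
      · have he : e = Event.res none () := by
          have := congrArg List.getLast? hd1
          simpa using this.symm
        subst he
        have : Event.res none () ∈ [Event.inv none v] ++ b := by
          rw [hd2]; simp
        simp [hb] at this
  · rw [List.concat_eq_append, ← List.append_assoc] at habc
    have := (List.append_inj' habc rfl).2
    simp_all

/-! ### Runs and indistinguishability -/

namespace Algorithm

variable {n b : ℕ} {A : Algorithm.{u} r n m b}

/-- `A.Run C es D`: a finite sequence of steps with events `es` leads from `C` to `D`. -/
inductive Run (A : Algorithm.{u} r n m b) : A.Config → List (Event r m) → A.Config → Prop
  | nil (C : A.Config) : Run A C [] C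
  | snoc {C D E : A.Config} {es : List (Event r m)} {e : Event r m} :
      Run A C es D → A.Step D e E → Run A C (es ++ [e]) E

theorem Run.single {C D : A.Config} {e : Event r m} (h : A.Step C e D) : A.Run C [e] D :=
  Run.snoc (Run.nil C) h

theorem Run.trans {C D E : A.Config} {es fs : List (Event r m)} (h₁ : A.Run C es D)
    (h₂ : A.Run D fs E) : A.Run C (es ++ fs) E := by
  induction h₂ with
  | nil => simpa using h₁
  | snoc _ hs ih => rw [← List.append_assoc]; exact Run.snoc ih hs

theorem Execution.append {C D : A.Config} {h es : List (Event r m)} (h₁ : A.Execution h C)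
    (h₂ : A.Run C es D) : A.Execution (h ++ es) D := by
  induction h₂ with
  | nil => simpa using h₁
  | snoc _ hs ih => rw [← List.append_assoc]; exact Execution.snoc ih hs

/-- Two configurations look the same to process `p`. -/
def Agree (p : Proc r) (C D : A.Config) : Prop :=
  C.mem = D.mem ∧ C.state p = D.state p ∧ C.active p = D.active p

/-- Two configurations agree on the local part of all processes other than `p`. -/
def AgreeOff (p : Proc r) (C D : A.Config) : Prop :=
  ∀ q, q ≠ p → C.state q = D.state q ∧ C.active q = D.active q

theorem Step.agreeOff {C D : A.Config} {e : Event r m} (h : A.Step C e D) :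
    AgreeOff e.proc C D := by
  intro q hq
  cases h <;> simp_all [Event.proc]

theorem AgreeOff.trans {p : Proc r} {C D E : A.Config} (h₁ : AgreeOff p C D)
    (h₂ : AgreeOff p D E) : AgreeOff p C E :=
  fun q hq => ⟨(h₁ q hq).1.trans (h₂ q hq).1, (h₁ q hq).2.trans (h₂ q hq).2⟩

theorem Run.agreeOff {p : Proc r} {C D : A.Config} {es : List (Event r m)} (h : A.Run C es D)
    (hes : ∀ e ∈ es, e.proc = p) : AgreeOff p C D := by
  induction h with
  | nil => exact fun q _ => ⟨rfl, rfl⟩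
  | snoc _ hs ih =>
    have h₂ := hs.agreeOff
    rw [hes _ (by simp)] at h₂
    exact (ih fun e he => hes e (by simp [he])).trans h₂

/-- A step depends only on the shared memory and the local part of its own process. This carries
solo runs from one configuration to another. -/
theorem Step.lift {C C' D : A.Config} {e : Event r m} (h : A.Step C e C')
    (hCD : Agree e.proc C D) : ∃ D', A.Step D e D' ∧ Agree e.proc C' D' := by
  obtain ⟨hm, hs, ha⟩ := hCD
  cases h with
  | inv p o idle =>
    refine ⟨_, Step.inv D p o (ha ▸ idle), hm, ?_, ?_⟩
    · simp_all [Event.proc]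
    · simp [Event.proc]
  | read p i k busy hact =>
    refine ⟨_, Step.read D p i k (ha ▸ busy) (hs ▸ hact), hm, ?_, ha⟩
    simp [Event.proc, hm]
  | write p i x s busy hact =>
    refine ⟨_, Step.write D p i x s (ha ▸ busy) (hs ▸ hact), ?_, ?_, ha⟩
    · simp [hm]
    · simp [Event.proc]
  | res p y s busy hact =>
    refine ⟨_, Step.res D p y s (ha ▸ busy) (hs ▸ hact), hm, ?_, ?_⟩
    · simp [Event.proc]
    · simp [Event.proc]

theorem Run.lift {p : Proc r} {C C' D : A.Config} {es : List (Event r m)} (h : A.Run C es C')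
    (hes : ∀ e ∈ es, e.proc = p) (hCD : Agree p C D) :
    ∃ D', A.Run D es D' ∧ Agree p C' D' := by
  induction h with
  | nil => exact ⟨D, Run.nil D, hCD⟩
  | @snoc E F es e _ hs ih =>
    obtain ⟨D₁, hr, hag⟩ := ih fun e he => hes e (by simp [he])
    have hp : e.proc = p := hes e (by simp)
    subst hp
    obtain ⟨D₂, hs₂, hag₂⟩ := hs.lift hag
    exact ⟨D₂, hr.snoc hs₂, hag₂⟩

theorem Run.of_reflTransGen {p : Proc r} {C D : A.Config}
    (h : Relation.ReflTransGen (fun D D' : A.Config => A.Step D (Event.access p) D') C D) :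
    ∃ es : List (Event r m), (∀ e ∈ es, e = Event.access p) ∧ A.Run C es D := by
  induction h with
  | refl => exact ⟨[], by simp, Run.nil C⟩
  | tail _ hs ih =>
    obtain ⟨es, hes, hr⟩ := ih
    refine ⟨es ++ [Event.access p], ?_, hr.snoc hs⟩
    intro e he
    rcases List.mem_append.1 he with he | he
    · exact hes e he
    · simpa using he

theorem Step.not_active_of_res {p : Proc r} {y : Res m p} {C D : A.Config}
    (h : A.Step C (Event.res p y) D) : D.active p = false := by
  cases h
  simp

/-! ### Solo operations from obstruction-freedom -/

/-- An idle process can invoke an operation and complete it in isolation. -/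
theorem ObstructionFree.solo (hof : A.ObstructionFree) {h : List (Event r m)} {C : A.Config}
    (hC : A.Execution h C) {p : Proc r} (hidle : C.active p = false) (o : Op m p) :
    ∃ (es : List (Event r m)) (y : Res m p) (D : A.Config),
      (∀ e ∈ es, e = Event.access p) ∧ D.active p = false ∧
        A.Run C ([Event.inv p o] ++ es ++ [Event.res p y]) D := by
  have hs := Step.inv C p o hidle
  obtain ⟨C₁, C₂, y, h₁, h₂⟩ := hof _ _ (hC.snoc hs) p (by simp)
  obtain ⟨es, hes, hr⟩ := Run.of_reflTransGen h₁
  exact ⟨es, y, C₂, hes, h₂.not_active_of_res, ((Run.single hs).trans hr).snoc h₂⟩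

/-- The writer can complete its pending write, if any. -/
theorem ObstructionFree.writer_becomes_idle (hof : A.ObstructionFree) {h : List (Event r m)}
    {C : A.Config} (hC : A.Execution h C) (V : Finset (Fin m)) :
    ∃ (es : List (Event r m)) (D : A.Config),
      (∀ e ∈ es, WriterEvent V e) ∧ D.active none = false ∧ A.Run C es D := by
  cases hact : C.active none with
  | false => exact ⟨[], C, by simp, hact, Run.nil C⟩
  | true =>
    obtain ⟨C₁, C₂, y, h₁, h₂⟩ := hof _ _ hC none hact
    obtain ⟨es, hes, hr⟩ := Run.of_reflTransGen h₁
    refine ⟨_, C₂, ?_, h₂.not_active_of_res, hr.snoc h₂⟩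
    intro e he
    rcases List.mem_append.1 he with he | he
    · rw [hes e he]; exact writerEvent_access V
    · rw [List.mem_singleton.1 he]; exact writerEvent_res V y

/-- The writer can reach a point at which a write of `u` is the last completed write and no
write is pending. -/
theorem ObstructionFree.write_twice (hof : A.ObstructionFree) {h : List (Event r m)}
    {C : A.Config} (hC : A.Execution h C) {V : Finset (Fin m)} {u : Fin m} (hu : u ∈ V) :
    ∃ (es : List (Event r m)) (D : A.Config), (∀ e ∈ es, WriterEvent V e) ∧ A.Run C es D ∧
      (∀ v₀ v, LastCompletedWrite v₀ (h ++ es) v → v = u) ∧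
      ∀ v, ¬ PendingWrite (h ++ es) v := by
  obtain ⟨es₀, C₀, hes₀, hidle₀, hr₀⟩ := hof.writer_becomes_idle hC V
  have hC₀ := hC.append hr₀
  obtain ⟨es₁, y₁, C₁, hes₁, hidle₁, hr₁⟩ := hof.solo hC₀ hidle₀ (p := none) u
  have hC₁ := hC₀.append hr₁
  -- The second write puts a single invocation between two responses, so the last completed write is
  -- determined without any knowledge of `h`.
  obtain ⟨es₂, y₂, C₂, hes₂, -, hr₂⟩ := hof.solo hC₁ hidle₁ (p := none) u
  refine ⟨es₀ ++ ([Event.inv none u] ++ es₁ ++ [Event.res none y₁]) ++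
    ([Event.inv none u] ++ es₂ ++ [Event.res none y₂]), C₂, ?_, (hr₀.trans hr₁).trans hr₂,
    ?_, ?_⟩
  · intro e he
    simp only [List.mem_append, List.mem_singleton] at he
    rcases he with (he | (he | he) | he) | (he | he) | he
    · exact hes₀ e he
    · rw [he]; exact writerEvent_inv hu
    · rw [hes₁ e he]; exact writerEvent_access V
    · rw [he]; exact writerEvent_res V y₁
    · rw [he]; exact writerEvent_inv hu
    · rw [hes₂ e he]; exact writerEvent_access V
    · rw [he]; exact writerEvent_res V y₂
  · intro v₀ v hv
    have := LastCompletedWrite.inv_mem_between (v₀ := v₀) (v := v)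
      (g := h ++ es₀ ++ [Event.inv none u] ++ es₁) (k := [Event.inv none u] ++ es₂)
      (by simpa only [List.append_assoc] using hv)
    rcases List.mem_append.1 this with h' | h'
    · simpa using h'
    · cases hes₂ _ h'
  · intro v hv
    refine not_pendingWrite_of_ends_with_res (v := v)
      (h := h ++ es₀ ++ [Event.inv none u] ++ es₁ ++ [Event.res none ()] ++
        [Event.inv none u] ++ es₂) ?_
    simpa only [List.append_assoc] using hv

/-! ### A silent reader: counting available pairs -/

/-- The pairs `(i, x)` such that the writer, writing only values from `V`, can bring physical
register `i` to contain `x`. -/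
def Avail (C : A.Config) (V : Finset (Fin m)) : Set (Fin n × Fin b) :=
  {ix | ∃ (es : List (Event r m)) (D : A.Config),
    (∀ e ∈ es, WriterEvent V e) ∧ A.Run C es D ∧ D.mem ix.1 = ix.2}

theorem mem_avail_self (C : A.Config) (V : Finset (Fin m)) (i : Fin n) :
    (i, C.mem i) ∈ Avail C V :=
  ⟨[], C, by simp, Run.nil C, rfl⟩

theorem avail_subset {C D : A.Config} {V W : Finset (Fin m)} (hVW : W ⊆ V)
    {es : List (Event r m)} (hes : ∀ e ∈ es, WriterEvent V e) (hr : A.Run C es D) :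
    Avail D W ⊆ Avail C V := by
  rintro ix ⟨fs, E, hfs, hr', hE⟩
  refine ⟨es ++ fs, E, ?_, hr.trans hr', hE⟩
  intro e he
  rcases List.mem_append.1 he with he | he
  · exact hes e he
  · exact (hfs e he).mono hVW

/-- A read of a reader that does not write can be repeated, with the same result, while the writer
writes only values from `W`, provided these writes can always restore each register. -/
theorem replay {j : Fin r} (hj : ∀ i, A.owner i ≠ some j) {V W : Finset (Fin m)} (hWV : W ⊆ V)
    {C : A.Config}
    (hav : ∀ (es : List (Event r m)) (D : A.Config), (∀ e ∈ es, WriterEvent V e) →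
      A.Run C es D → ∀ i, (i, C.mem i) ∈ Avail D W)
    {D D' : A.Config}
    (hrun : Relation.ReflTransGen
      (fun D D' : A.Config => A.Step D (Event.access (some j)) D') D D')
    (hD : D.mem = C.mem) {E F : A.Config} {es : List (Event r m)}
    (hes : ∀ e ∈ es, WriterEvent V e) (hF : A.Run C es F)
    (hEF : Agree none F E) (hst : D.state (some j) = E.state (some j))
    (hac : D.active (some j) = E.active (some j)) :
    D'.mem = C.mem ∧ ∃ (fs : List (Event r m)) (E' : A.Config),
      (∀ e ∈ fs, e = Event.access (some j) ∨ WriterEvent W e) ∧ A.Run E fs E' ∧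
      D'.state (some j) = E'.state (some j) ∧ D'.active (some j) = E'.active (some j) := by
  -- `F'` is the twin of `E'` without the reader's steps. It is needed because `hav` speaks only of
  -- writer runs from `C`; the runs it yields are lifted to `E'`.
  suffices H : D'.mem = C.mem ∧ ∃ (fs gs : List (Event r m)) (E' F' : A.Config),
      (∀ e ∈ fs, e = Event.access (some j) ∨ WriterEvent W e) ∧ A.Run E fs E' ∧
      (∀ e ∈ gs, WriterEvent V e) ∧ A.Run C gs F' ∧ Agree none F' E' ∧
      D'.state (some j) = E'.state (some j) ∧ D'.active (some j) = E'.active (some j) by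
    obtain ⟨h, fs, _, E', _, h₁, h₂, _, _, _, h₃, h₄⟩ := H
    exact ⟨h, fs, E', h₁, h₂, h₃, h₄⟩
  induction hrun with
  | refl => exact ⟨hD, [], es, E, F, by simp, Run.nil E, hes, hF, hEF, hst, hac⟩
  | tail _ hs ih =>
    obtain ⟨hm, fs, gs, E₁, F₁, hfs, hE₁, hgs, hF₁, hag, hst₁, hac₁⟩ := ih
    cases hs with
    | write _ i x s busy hact => exact absurd (A.single_writer _ _ _ _ _ hact) (hj i)
    | read _ i k busy hact =>
      -- The writer restores register `i` just before it is read; the other registers may hold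
      -- anything.
      obtain ⟨ks, F₂, hks, hF₂, hi⟩ := hav gs F₁ hgs hF₁ i
      obtain ⟨E₂, hE₂, hag₂⟩ := hF₂.lift (fun e he => (hks e he).1) hag
      have hoff := hE₂.agreeOff (fun e he => (hks e he).1) (some j) (by simp)
      have hstep := Step.read E₂ (some j) i k (by rw [← hoff.2, ← hac₁]; exact busy)
        (by rw [← hoff.1, ← hst₁]; exact hact)
      refine ⟨hm, fs ++ ks ++ [Event.access (some j)], gs ++ ks, _, F₂, ?_,
        (hE₁.trans hE₂).snoc hstep, ?_, hF₁.trans hF₂, ⟨hag₂.1, ?_, hag₂.2.2⟩, ?_, ?_⟩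
      · intro e he
        simp only [List.mem_append, List.mem_singleton] at he
        rcases he with (he | he) | he
        · exact hfs e he
        · exact Or.inr (hks e he)
        · exact Or.inl he
      · intro e he
        rcases List.mem_append.1 he with he | he
        · exact hgs e he
        · exact (hks e he).mono hWV
      · simpa using hag₂.2.1
      · simp only [Function.update_self]
        rw [hm, ← hag₂.1, hi]
      · exact hac₁.trans hoff.2

/-- If a reader does not write, then some value `v` can be removed from `V` such that the writer,
possibly after further writes of values from `V`, loses one of its available pairs. -/
theorem exists_avail_ssubset (hreg : A.ImplementsRegular) (hof : A.ObstructionFree) {j : Fin r}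
    (hj : ∀ i, A.owner i ≠ some j) {V : Finset (Fin m)} (hV : 1 < V.card)
    {h : List (Event r m)} {C : A.Config} (hC : A.Execution h C)
    (hidle : C.active (some j) = false) :
    ∃ v ∈ V, ∃ (es : List (Event r m)) (D : A.Config), (∀ e ∈ es, WriterEvent V e) ∧
      A.Run C es D ∧ Avail D (V.erase v) ⊂ Avail C V := by
  obtain ⟨v₀, hreg⟩ := hreg
  have hs := Step.inv C (some j) () hidle
  obtain ⟨C₁, C₂, y, h₁, h₂⟩ := hof _ _ (hC.snoc hs) (some j) (by simp)
  -- All that matters is that `y` is not among the values that remain.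
  obtain ⟨v, hv, hy⟩ : ∃ v ∈ V, y ∉ V.erase v := by
    by_cases hyV : y ∈ V
    · exact ⟨y, hyV, by simp⟩
    · obtain ⟨v, hv⟩ := Finset.card_pos.1 (by omega : 0 < V.card)
      exact ⟨v, hv, fun hy => hyV (Finset.mem_of_mem_erase hy)⟩
  refine ⟨v, hv, ?_⟩
  by_contra hcon
  have hav : ∀ (es : List (Event r m)) (D : A.Config), (∀ e ∈ es, WriterEvent V e) →
      A.Run C es D → ∀ i, (i, C.mem i) ∈ Avail D (V.erase v) := by
    intro es D hes hr i
    by_contra hi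
    exact hcon ⟨es, D, hes, hr, avail_subset (Finset.erase_subset v V) hes hr,
      fun hsub => hi (hsub (mem_avail_self C V i))⟩
  obtain ⟨u, hu⟩ : (V.erase v).Nonempty := by
    rw [← Finset.card_pos, Finset.card_erase_of_mem hv]; omega
  obtain ⟨es, F, hes, hF, hlast, hpend⟩ := hof.write_twice hC hu
  have hoff := hF.agreeOff (fun e he => (hes e he).1) (some j) (by simp)
  have hs' := Step.inv F (some j) () (by rw [← hoff.2]; exact hidle)
  obtain ⟨-, fs, E, hfs, hE, hst, hac⟩ := replay hj (Finset.erase_subset v V) hav h₁ rfl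
    (fun e he => (hes e he).mono (Finset.erase_subset v V)) hF
    (E := { mem := F.mem
            state := Function.update F.state (some j) (A.start (some j) () (F.state (some j)))
            active := Function.update F.active (some j) true })
    ⟨rfl, by simp, by simp⟩ (by simp [hoff.1]) (by simp)
  cases h₂ with
  | res _ _ s busy hact =>
    have hend := Step.res E (some j) y s (by rw [← hac]; exact busy) (by rw [← hst]; exact hact)
    have hexec := (((hC.append hF).snoc hs').append hE).snoc hend
    -- The last completed write is of `u`, none is pending, and concurrent writes use only `V.erase
    -- v`: none of them can be of `y`.
    rcases hreg _ _ hexec j y (h ++ es) fs [] (by simp) (fun w hw => by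
      rcases hfs _ hw with h' | h'
      · cases h'
      · cases h'.1) with h' | h' | h'
    · exact hy (hlast _ _ h' ▸ hu)
    · exact hpend _ h'
    · rcases hfs _ h' with h'' | h''
      · cases h''
      · exact hy (h''.2 y rfl)

/-- Induction on the number of values: the n current contents are always available, and each value
beyond the first accounts for one more pair by `exists_avail_ssubset`. -/
theorem card_le_ncard_avail (hreg : A.ImplementsRegular) (hof : A.ObstructionFree) {j : Fin r}
    (hj : ∀ i, A.owner i ≠ some j) (k : ℕ) :
    ∀ (V : Finset (Fin m)), V.card = k + 1 → ∀ (h : List (Event r m)) (C : A.Config),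
      A.Execution h C → C.active (some j) = false → n + k ≤ (Avail C V).ncard := by
  induction k with
  | zero =>
    intro V _ h C _ _
    have hsub : Set.range (fun i => (i, C.mem i)) ⊆ Avail C V := by
      rintro _ ⟨i, rfl⟩
      exact mem_avail_self C V i
    have hinj : Function.Injective (fun i => (i, C.mem i)) := fun i i' hi => congrArg Prod.fst hi
    have := Set.ncard_le_ncard hsub (Set.toFinite _)
    rw [Set.ncard_range_of_injective hinj, Nat.card_fin] at this
    simpa using this
  | succ k ih =>
    intro V hV h C hC hidle
    obtain ⟨v, hv, es, D, hes, hr, hlt⟩ :=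
      exists_avail_ssubset hreg hof hj (by omega : 1 < V.card) hC hidle
    have hoff := hr.agreeOff (fun e he => (hes e he).1) (some j) (by simp)
    have h₁ := ih (V.erase v) (by rw [Finset.card_erase_of_mem hv]; omega) _ D (hC.append hr)
      (by rw [← hoff.2]; exact hidle)
    have h₂ := Set.ncard_lt_ncard hlt (Set.toFinite _)
    omega

/-- If some reader never writes, then `n (b - 1) ≥ m - 1`. -/
theorem add_le_mul_add_one_of_silent_reader (hreg : A.ImplementsRegular)
    (hof : A.ObstructionFree) {j : Fin r} (hj : ∀ i, A.owner i ≠ some j) :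
    n + m ≤ n * b + 1 := by
  have hm : 0 < m := hreg.choose.pos
  have h₁ := card_le_ncard_avail hreg hof hj (m - 1) Finset.univ (by simp; omega) [] A.init
    Execution.nil rfl
  have h₂ := Set.ncard_le_ncard (Set.subset_univ (Avail A.init Finset.univ)) (Set.toFinite _)
  rw [Set.ncard_univ, Nat.card_prod, Nat.card_fin, Nat.card_fin] at h₂
  omega

/-! ### Counting the registers of the writer -/

theorem Run.mem_eq {p : Proc r} {C D : A.Config} {es : List (Event r m)} (h : A.Run C es D)
    (hes : ∀ e ∈ es, e.proc = p) {i : Fin n} (hi : A.owner i ≠ p) : D.mem i = C.mem i := by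
  induction h with
  | nil => rfl
  | @snoc E F es e _ hs ih =>
    rw [← ih fun e he => hes e (by simp [he])]
    have hp := hes e (by simp)
    cases hs with
    | write q i' x s busy hact =>
      have ho := A.single_writer _ _ _ _ _ hact
      have hne : i ≠ i' := by
        rintro rfl
        exact hi (ho.trans hp)
      simp [hne]
    | _ => rfl

/-- The registers of the writer can hold `m` different contents. -/
theorem le_pow_card_writer_registers (hr : 1 ≤ r) (hreg : A.ImplementsRegular)
    (hof : A.ObstructionFree) : m ≤ b ^ Fintype.card {i // A.owner i = none} := by
  obtain ⟨v₀, hreg⟩ := hreg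
  let j : Fin r := ⟨0, hr⟩
  choose es y D hes hidle hrun using
    fun v : Fin m => hof.solo (Execution.nil (A := A)) (p := none) rfl v
  have hproc : ∀ v, ∀ e ∈ ([Event.inv none v] ++ es v ++ [Event.res none (y v)] :
      List (Event r m)), e.proc = none := by
    intro v e he
    simp only [List.mem_append, List.mem_singleton] at he
    rcases he with (he | he) | he
    · rw [he]; rfl
    · rw [hes v e he]; rfl
    · rw [he]; rfl
  have hoff := fun v => (hrun v).agreeOff (hproc v) (some j) (by simp)
  have hexec := fun v => Execution.nil.append (hrun v)
  have hread : ∀ (v : Fin m) (fs : List (Event r m)) (w : Fin m) (E : A.Config),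
      (∀ e ∈ fs, e = Event.access (some j)) →
      A.Run (D v) ([Event.inv (some j) ()] ++ fs ++ [Event.res (some j) w]) E → w = v := by
    intro v fs w E hfs hE
    have hinv : Event.inv none w ∈
        ([Event.inv none v] ++ es v ++ [Event.res none (y v)] : List (Event r m)) := by
      rcases hreg _ _ ((hexec v).append hE) j w
        ([Event.inv none v] ++ es v ++ [Event.res none (y v)]) fs [] (by simp) (fun w' hw' => by
        cases hfs _ hw') with h' | h' | h'
      · exact h'.inv_mem (by simp)
      · exact h'.inv_mem
      · cases hfs _ h'
    simp only [List.mem_append, List.mem_singleton] at hinv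
    rcases hinv with (h' | h') | h'
    · cases h'; rfl
    · cases hes v _ h'
    · cases h'
  have hinj : Function.Injective
      (fun (v : Fin m) (i : {i // A.owner i = none}) => (D v).mem i) := by
    intro v v' hvv
    have hmem : (D v).mem = (D v').mem := by
      funext i
      by_cases hi : A.owner i = none
      · exact congrFun hvv ⟨i, hi⟩
      · rw [(hrun v).mem_eq (hproc v) hi, (hrun v').mem_eq (hproc v') hi]
    obtain ⟨fs, w, E, hfs, -, hE⟩ := hof.solo (hexec v) (p := some j) (hoff v).2.symm ()
    -- With equal memories, the reader cannot tell `D v` from `D v'`, so the same read is possible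
    -- after both writes.
    obtain ⟨E', hE', -⟩ := hE.lift (p := some j) (fun e he => by
      simp only [List.mem_append, List.mem_singleton] at he
      rcases he with (he | he) | he
      · rw [he]; rfl
      · rw [hfs e he]; rfl
      · rw [he]; rfl) (D := D v')
      ⟨hmem, (hoff v).1.symm.trans (hoff v').1, (hoff v).2.symm.trans (hoff v').2⟩
    exact (hread v fs w E hfs hE).symm.trans (hread v' fs w E' hfs hE')
  simpa using Fintype.card_le_of_injective _ hinj

theorem card_writer_registers_add_le (hown : ∀ j : Fin r, ∃ i, A.owner i = some j) :
    Fintype.card {i // A.owner i = none} + r ≤ n := by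
  choose f hf using hown
  have hinj : Function.Injective
      (Sum.elim Subtype.val f : {i // A.owner i = none} ⊕ Fin r → Fin n) := by
    refine Function.Injective.sumElim Subtype.val_injective ?_ ?_
    · intro j j' hjj
      exact Option.some.inj ((hf j).symm.trans (hjj ▸ hf j'))
    · rintro ⟨i, hi⟩ j rfl
      cases hi.symm.trans (hf j)
  simpa using Fintype.card_le_of_injective _ hinj

end Algorithm

end SharedRegister

/-! ### The lower bound -/

theorem theorem2 (r n m b : ℕ) (hr : 1 ≤ r) (hb : 2 ≤ b)
    (A : SharedRegister.Algorithm.{u} r n m b)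
    (hreg : A.ImplementsRegular) (hof : A.ObstructionFree) :
    ⌈min (((m : ℝ) - 1) / ((b : ℝ) - 1)) ((r : ℝ) + Real.log (m : ℝ) / Real.log (b : ℝ))⌉
      ≤ (n : ℤ) := by
  rw [Int.ceil_le, Int.cast_natCast]
  have hb' : (2 : ℝ) ≤ b := by exact_mod_cast hb
  by_cases hown : ∀ j : Fin r, ∃ i, A.owner i = some j
  · refine (min_le_right _ _).trans ?_
    have hm : (0 : ℝ) < m := by exact_mod_cast hreg.choose.pos
    have h₁ : (m : ℝ) ≤ (b : ℝ) ^ Fintype.card {i // A.owner i = none} := by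
      exact_mod_cast SharedRegister.Algorithm.le_pow_card_writer_registers hr hreg hof
    have h₂ : (Fintype.card {i // A.owner i = none} : ℝ) + r ≤ n := by
      exact_mod_cast SharedRegister.Algorithm.card_writer_registers_add_le hown
    have h₃ : Real.log m / Real.log b ≤ Fintype.card {i // A.owner i = none} := by
      rw [div_le_iff₀ (Real.log_pos (by linarith)), ← Real.log_pow]
      exact Real.log_le_log hm h₁
    linarith
  · push Not at hown
    obtain ⟨j, hj⟩ := hown
    refine (min_le_left _ _).trans ?_
    have h : (n : ℝ) + m ≤ n * b + 1 := by
      exact_mod_cast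
        SharedRegister.Algorithm.add_le_mul_add_one_of_silent_reader hreg hof hj
    rw [div_le_iff₀ (by linarith)]
    linarith
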